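/- **Definitions.** For $a\in\mathbb N_0$ let ${}^{0}a=1$ and ${}^{b+1}a=a^{({}^{b}a)}$. For $a\ge 2$ and $b\ge 0$ let $N(a,b)$ be the largest $n$ with ${}^{b}a\equiv{}^{b+1}a\pmod{10^n}$, and for $b\ge 1$ let $V(a,b)=N(a,b)-N(a,b-1)$. By convention $V(1,1)=1$, $V(1,b)=0$ for $b\ge2$, and $V(0,b)=0$ for $b\ge1$. The *constant congruence speed* is $V(a)=V(a,\bar b)$, where $\bar b\ge1$ is the least height such that $V(a,\bar b+k)=V(a,\bar b)$ for all $k\ge0$; $V(a)$ is undefined if there is no such height. For a prime $p$, $v_p$ is the $p$-adic valuation on $\mathbb Z$. Let $E=\{(0,1),(0,7),(4,3),(4,9),(5,1),(5,7),(9,3),(9,9)\}$. For $(x_2,x_1)\in E$ let $\alpha_{x_2x_1}$ be the unique solution of $y^5=y$ in the ring $\mathbb Z_{10}$ of decadic integers whose last two decimal digits are $x_2x_1$, and let $\alpha_{x_2x_1}[j]$ be its $j$-th digit from the right. Write $a=\sum_{j\ge1}s_j10^{j-1}$ with decimal digits $s_j$ ($s_j=0$ beyond the leading digit). If $a\ge2$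 and $s_1=x_1$, then $l\ge 2$ denotes the unique index with $a\equiv\alpha_{x_2x_1}\pmod{10^{l-1}}$ and $a\not\equiv\alpha_{x_2x_1}\pmod{10^{l}}$, and $s_l$ is the *key digit* of $a$ relative to $\alpha_{x_2x_1}$. **Claim.** All these objects are well defined: for each $(x_2,x_1)\in E$ the solution $\alpha_{x_2x_1}$ exists and is unique; for each $a\ge2$ and $(x_2,x_1)\in E$ with $s_1=x_1$ the index $l$ exists, and $l\ge3$ if also $s_2=x_2$; and $V(a)$ is defined for every $a\in\mathbb N_0$ that is $0$ or not a multiple of $10$. Moreover: (A) For every $a\ge2$ coprime to $10$ (with $l$ and $s_l$ taken relative to $\alpha_{s_2s_1}$ when $(s_2,s_1)\in E$), $$V(a)=\begin{cases} v_5(a-1)&\text{if }(s_2,s_1)=(0,1),\ s_l\ne5\\ v_2(a-1)&\text{if }(s_2,s_1)=(0,1),\ s_l=5\\ v_5(a-1)&\text{if }(s_2,s_1)=(5,1),\ |s_l-\alpha_{51}[l]|\ne5\\ v_2(a+1)&\text{if }(s_2,s_1)=(5,1),\ |s_l-\alpha_{51}[l]|=5\\ v_5(a^2+1)&\text{if }(s_2,s_1)=(4,3),\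 |s_l-\alpha_{43}[l]|\ne5\\ v_2(a+1)&\text{if }(s_2,s_1)=(4,3),\ |s_l-\alpha_{43}[l]|=5\\ v_5(a^2+1)&\text{if }(s_2,s_1)=(9,3),\ |s_l-\alpha_{93}[l]|\ne5\\ v_2(a-1)&\text{if }(s_2,s_1)=(9,3),\ |s_l-\alpha_{93}[l]|=5\\ v_5(a^2+1)&\text{if }(s_2,s_1)=(0,7),\ |s_l-\alpha_{07}[l]|\ne5\\ v_2(a+1)&\text{if }(s_2,s_1)=(0,7),\ |s_l-\alpha_{07}[l]|=5\\ v_5(a^2+1)&\text{if }(s_2,s_1)=(5,7),\ |s_l-\alpha_{57}[l]|\ne5\\ v_2(a-1)&\text{if }(s_2,s_1)=(5,7),\ |s_l-\alpha_{57}[l]|=5\\ v_5(a+1)&\text{if }(s_2,s_1)=(4,9),\ |s_l-\alpha_{49}[l]|\ne5\\ v_2(a-1)&\text{if }(s_2,s_1)=(4,9),\ |s_l-\alpha_{49}[l]|=5\\ v_5(a+1)&\text{if }(s_2,s_1)=(9,9),\ s_l\ne4\\ v_2(a+1)&\text{if }(s_2,s_1)=(9,9),\ s_l=4\\ 1&\text{if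 }(s_2,s_1)\notin E. \end{cases}$$ (B) For every $a\in\mathbb N_0$ (with $l$ and $s_l$ taken relative to the $\alpha$ named in the line, relative to $\alpha_{01}$ for $a\equiv1\pmod{20}$ and to $\alpha_{99}$ for $a\equiv19\pmod{20}$), $$V(a)=\begin{cases} 0&\text{if }a\in\{0,1\}\\ v_5(a^2+1)&\text{if }a\equiv2,8\pmod{10}\\ v_5(a+1)&\text{if }a\equiv4\pmod{10}\\ v_5(a-1)&\text{if }a\equiv6\pmod{10}\\ v_2(a-1)&\text{if }a\equiv5\pmod{20}\\ v_2(a+1)&\text{if }a\equiv15\pmod{20}\\ v_5(a-1)&\text{if }a\equiv1\pmod{20},\ a\ne1,\ s_l\ne5\\ v_2(a-1)&\text{if }a\equiv1\pmod{20},\ a\ne1,\ s_l=5\\ v_5(a-1)&\text{if }a\equiv11\pmod{20},\ |s_l-\alpha_{51}[l]|\ne5\\ v_2(a+1)&\text{if }a\equiv11\pmod{20},\ |s_l-\alpha_{51}[l]|=5\\ v_5(a^2+1)&\text{if }a\equiv3\pmod{20},\ |s_l-\alpha_{43}[l]|\ne5\\ v_2(a+1)&\text{if }a\equiv3\pmod{20},\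 |s_l-\alpha_{43}[l]|=5\\ v_5(a^2+1)&\text{if }a\equiv13\pmod{20},\ |s_l-\alpha_{93}[l]|\ne5\\ v_2(a-1)&\text{if }a\equiv13\pmod{20},\ |s_l-\alpha_{93}[l]|=5\\ v_5(a^2+1)&\text{if }a\equiv7\pmod{20},\ |s_l-\alpha_{07}[l]|\ne5\\ v_2(a+1)&\text{if }a\equiv7\pmod{20},\ |s_l-\alpha_{07}[l]|=5\\ v_5(a^2+1)&\text{if }a\equiv17\pmod{20},\ |s_l-\alpha_{57}[l]|\ne5\\ v_2(a-1)&\text{if }a\equiv17\pmod{20},\ |s_l-\alpha_{57}[l]|=5\\ v_5(a+1)&\text{if }a\equiv9\pmod{20},\ |s_l-\alpha_{49}[l]|\ne5\\ v_2(a-1)&\text{if }a\equiv9\pmod{20},\ |s_l-\alpha_{49}[l]|=5\\ v_5(a+1)&\text{if }a\equiv19\pmod{20},\ s_l\ne4\\ v_2(a+1)&\text{if }a\equiv19\pmod{20},\ s_l=4, \end{cases}$$ and $V(a)$ is undefined if and only if $a\equiv0\pmod{10}$ and $a\ne0$. -/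

import Mathlib

namespace Tetration

/-- The tetration `ᵇa`: `¹a = a` and `ᵇ⁺¹a = a ^ (ᵇa)`, started at the usual value `⁰a = 1`.
For `a = 0` this gives `ᵇ0 = 1` for even `b` and `ᵇ0 = 0` for odd `b`. -/
def tet (a : ℕ) : ℕ → ℕ
  | 0 => 1
  | b + 1 => a ^ tet a b

/-- The `n` with `ᵇa ≡ ᵇ⁺¹a (mod 10 ^ n)` and `ᵇa ≢ ᵇ⁺¹a (mod 10 ^ (n + 1))`.
(For `a ≠ 1` the two numbers are different, so that this `n` exists.) -/
noncomputable def stableDigits (a b : ℕ) : ℕ :=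
  multiplicity (10 : ℤ) ((tet a (b + 1) : ℤ) - (tet a b : ℤ))

/-- The congruence speed `V(a, b)` of the base `a` at height `b ≥ 1`: the number of digits
gained from height `b - 1` to height `b`. The bases `0` and `1` have conventional values. -/
noncomputable def congruenceSpeed (a b : ℕ) : ℤ :=
  if a = 0 then 0
  else if a = 1 then (if b = 1 then 1 else 0)
  else (stableDigits a b : ℤ) - (stableDigits a (b - 1) : ℤ)

/-- `b ≥ 1` is a height from which on the congruence speed of `a` is constant. -/
def IsStableHeight (a b : ℕ) : Prop :=
  1 ≤ b ∧ ∀ k : ℕ, congruenceSpeed a b = congruenceSpeed a (b + k)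

/-- The least height from which on the congruence speed of `a` is constant
(meaningful when there is such a height). -/
noncomputable def optimalHeight (a : ℕ) : ℕ :=
  sInf {b : ℕ | IsStableHeight a b}

/-- The constant congruence speed `V(a)`
(meaningful when there is a height from which on the congruence speed is constant). -/
noncomputable def V (a : ℕ) : ℤ :=
  congruenceSpeed a (optimalHeight a)

/-- The ring of decadic (10-adic) integers, the inverse limit of the rings `ℤ / 10 ^ n`,
as a subring of their product. -/
def decadicSubring : Subring (∀ n : ℕ, ZMod (10 ^ n)) where
  carrier := {f | ∀ (m n : ℕ) (h : m ≤ n),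
    ZMod.castHom (pow_dvd_pow 10 h) (ZMod (10 ^ m)) (f n) = f m}
  mul_mem' := by
    intro f g hf hg m n h
    rw [Pi.mul_apply, Pi.mul_apply, map_mul, hf m n h, hg m n h]
  one_mem' := by
    intro m n h
    rw [Pi.one_apply, Pi.one_apply, map_one]
  add_mem' := by
    intro f g hf hg m n h
    rw [Pi.add_apply, Pi.add_apply, map_add, hf m n h, hg m n h]
  zero_mem' := by
    intro m n h
    rw [Pi.zero_apply, Pi.zero_apply, map_zero]
  neg_mem' := by
    intro f hf m n h
    rw [Pi.neg_apply, Pi.neg_apply, map_neg, hf m n h]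

/-- The type of decadic integers, a commutative ring. -/
abbrev Decadic : Type := decadicSubring

/-- `y` modulo `10 ^ n`. -/
def Decadic.residue (y : Decadic) (n : ℕ) : ZMod (10 ^ n) := y.1 n

/-- `y[n]`, the `n`-th rightmost decimal digit of the decadic integer `y` (for `n ≥ 1`). -/
def Decadic.digit (y : Decadic) (n : ℕ) : ℕ := (y.residue n).val / 10 ^ (n - 1)

/-- `s_n`, the `n`-th rightmost decimal digit of the natural number `a` (for `n ≥ 1`);
it is `0` to the left of the leading digit. -/
def digit (a n : ℕ) : ℕ := a / 10 ^ (n - 1) % 10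

/-- `y` is a solution of `y ^ 5 = y` whose last two digits are `x₂ x₁`. -/
def IsAlpha (x₂ x₁ : ℕ) (y : Decadic) : Prop :=
  y ^ 5 = y ∧ y.digit 1 = x₁ ∧ y.digit 2 = x₂

open Classical in
/-- The decadic integer `α_{x₂ x₁}`: the solution of `y ^ 5 = y` whose last two digits are
`x₂ x₁` (and `0` when there is none). -/
noncomputable def alpha (x₂ x₁ : ℕ) : Decadic :=
  if h : ∃ y : Decadic, IsAlpha x₂ x₁ y then h.choose else 0

/-- `l` is the position of the key digit of `a` relative to `y`, that is, `a` agrees with `y`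
modulo `10 ^ (l - 1)` but not modulo `10 ^ l`. -/
def IsKeyIndex (y : Decadic) (a l : ℕ) : Prop :=
  2 ≤ l ∧ (a : ZMod (10 ^ (l - 1))) = y.residue (l - 1) ∧ (a : ZMod (10 ^ l)) ≠ y.residue l

/-- The position `l` of the key digit of `a` relative to `α_{x₂ x₁}`. There is at most one. -/
noncomputable def keyIndex (x₂ x₁ a : ℕ) : ℕ :=
  sInf {l : ℕ | IsKeyIndex (alpha x₂ x₁) a l}

/-- The key digit `s_l` of `a` relative to `α_{x₂ x₁}`. -/
noncomputable def keyDigit (x₂ x₁ a : ℕ) : ℕ := digit a (keyIndex x₂ x₁ a)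

/-- `|s_l - α_{x₂ x₁}[l]|`, where `s_l` is the key digit of `a` relative to `α_{x₂ x₁}`. -/
noncomputable def keyGap (x₂ x₁ a : ℕ) : ℤ :=
  |(keyDigit x₂ x₁ a : ℤ) - ((alpha x₂ x₁).digit (keyIndex x₂ x₁ a) : ℤ)|

/-- The eight two-digit endings `(x₂, x₁)` of the solutions of `y ^ 5 = y` coprime to `10`. -/
def unitEndings : Finset (ℕ × ℕ) :=
  {(0, 1), (0, 7), (4, 3), (4, 9), (5, 1), (5, 7), (9, 3), (9, 9)}

/-- The `p`-adic valuation `v_p(d)` of a nonzero integer `d`. -/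
abbrev v (p : ℕ) (d : ℤ) : ℤ := (padicValInt p d : ℤ)

end Tetration

namespace Tetration

/-! Let a ≥ 2 and let d_b be the difference of the towers of heights b + 1 and b. Then d_{b+1} =
a^(ᵇa) · (a^(d_b) - 1), and N(a, b) is the smaller of v_2(d_b) and v_5(d_b). At a prime not dividing
a, lifting the exponent makes the valuation eventually linear in b, with slope v_5(a^4 - 1) at 5
(`padicValNat_five_tetGap_succ`) and v_2(a + 1) + v_2(a - 1) - 1 at 2
(`padicValNat_two_tetGap_succ`). The latter equals v_2(a - ε), where ε = ±1 and a ≡ ε mod 4. At a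
prime dividing a the valuation is at least the previous tower and outgrows any linear sequence. So
V(a) is the smaller slope if a is coprime to 10, and the slope at the other prime if exactly one of
2, 5 divides a; if 10 divides a, the speed never settles.

The key digit decides which slope is smaller (`padicValInt_compare`). Under ℤ_10 = ℤ_2 × ℤ_5 the
relevant α is the pair of ε and a fourth root of unity. Hence v_2(a - ε) and v_5(a^4 - 1) are the
valuations of a - α at 2 and 5. Both are at least l - 1 and, by the choice of l, not both at least
l. The digits in position l differ by 5 exactly when 5^l divides a - α; then 2 gives the minimum,
otherwise 5 does. -/

instance fact_prime_five : Fact (Nat.Prime 5) := ⟨by norm_num⟩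

/-! ### Growth of tetration -/

theorem two_mul_tet_le {a : ℕ} (ha : 1 < a) (b : ℕ) : 2 * tet a b ≤ tet a (b + 1) :=
  (Nat.mul_le_mul_right _ ha).trans (Nat.mul_le_pow ha.ne' _)

theorem succ_le_tet {a : ℕ} (ha : 1 < a) (b : ℕ) : b + 1 ≤ tet a b := by
  induction b with
  | zero => exact le_rfl
  | succ b ih => have := two_mul_tet_le ha b; omega

/-- Quadratic growth, which follows from doubling at each step, is all that is needed to beat the
linear valuations. -/
theorem mul_succ_le_two_mul_tet {a : ℕ} (ha : 1 < a) (b : ℕ) :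
    b * (b + 1) ≤ 2 * tet a b := by
  induction b with
  | zero => simp
  | succ b ih =>
    have h1 := two_mul_tet_le ha b
    have h2 := succ_le_tet ha b
    nlinarith

theorem exists_linear_le_tet {a : ℕ} (ha : 1 < a) (c s : ℕ) :
    ∃ B, ∀ b ≥ B, c + s * b ≤ tet a b := by
  refine ⟨2 * c + 2 * s + 1, fun b hb => ?_⟩
  have := mul_succ_le_two_mul_tet ha b
  nlinarith

/-- The difference of two consecutive tetrations. -/
def tetGap (a b : ℕ) : ℕ := tet a (b + 1) - tet a b

theorem tetGap_pos {a : ℕ} (ha : 1 < a) (b : ℕ) : 0 < tetGap a b := by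
  have h1 := two_mul_tet_le ha b
  have h2 := succ_le_tet ha b
  unfold tetGap; omega

theorem cast_tetGap {a : ℕ} (ha : 1 < a) (b : ℕ) :
    (tetGap a b : ℤ) = (tet a (b + 1) : ℤ) - (tet a b : ℤ) := by
  have h1 := two_mul_tet_le ha b
  unfold tetGap; push_cast [show tet a b ≤ tet a (b + 1) by omega]; ring

/-- This recursion carries the whole proof: lifting the exponent applies to the second factor, and
the first matters only at primes dividing `a`. -/
theorem tetGap_succ {a : ℕ} (ha : 1 < a) (b : ℕ) :
    tetGap a (b + 1) = a ^ tet a b * (a ^ tetGap a b - 1) := by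
  have h1 := two_mul_tet_le ha b
  rw [Nat.mul_sub, mul_one, ← pow_add, tetGap, tetGap, Nat.add_sub_cancel' (by omega)]
  rfl

theorem one_lt_pow_tetGap {a : ℕ} (ha : 1 < a) (b : ℕ) : 1 < a ^ tetGap a b :=
  Nat.one_lt_pow (tetGap_pos ha b).ne' ha

theorem stableDigits_eq_min {a : ℕ} (ha : 1 < a) (b : ℕ) :
    stableDigits a b = min (padicValNat 2 (tetGap a b)) (padicValNat 5 (tetGap a b)) := by
  have hd : tetGap a b ≠ 0 := (tetGap_pos ha b).ne'
  rw [stableDigits, ← cast_tetGap ha, show (10 : ℤ) = ((10 : ℕ) : ℤ) by norm_num,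
    Int.natCast_multiplicity]
  have key : ∀ n, 10 ^ n ∣ tetGap a b ↔
      n ≤ min (padicValNat 2 (tetGap a b)) (padicValNat 5 (tetGap a b)) := by
    intro n
    rw [le_min_iff, ← padicValNat_dvd_iff_le hd, ← padicValNat_dvd_iff_le hd]
    constructor
    · intro h
      exact ⟨(pow_dvd_pow_of_dvd (by norm_num) n).trans h,
        (pow_dvd_pow_of_dvd (by norm_num) n).trans h⟩
    · rintro ⟨h2, h5⟩
      rw [show 10 = 2 * 5 by norm_num, mul_pow]
      exact Nat.Coprime.mul_dvd_of_dvd_of_dvd (Nat.Coprime.pow _ _ (by norm_num)) h2 h5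
  refine multiplicity_eq_of_dvd_of_not_dvd ((key _).2 le_rfl) fun h => ?_
  have := (key _).1 h
  omega

/-! ### The valuations of the differences -/

/-- An odd square is 1 modulo 4, so an even gap forces the next gap to be divisible by 4. Lifting
the exponent needs an even exponent at 2, and a multiple of 4 at 5. -/
theorem dvd_tetGap_of_odd {a : ℕ} (ha : 1 < a) (ho : Odd a) (b : ℕ) :
    2 ∣ tetGap a b ∧ 4 ∣ tetGap a (b + 1) := by
  have hstep : ∀ b, 2 ∣ tetGap a b → 4 ∣ tetGap a (b + 1) := by
    intro b ⟨k, hk⟩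
    rw [tetGap_succ ha, hk, pow_mul]
    refine Dvd.dvd.mul_left ?_ _
    have h4 : a ^ 2 % 4 = 1 := by
      obtain ⟨m, rfl⟩ := ho
      rw [show (2 * m + 1) ^ 2 = 4 * (m ^ 2 + m) + 1 by ring]; omega
    have : (a ^ 2) ^ k ≡ 1 [MOD 4] := by simpa using Nat.ModEq.pow k (show a ^ 2 ≡ 1 [MOD 4] from h4)
    exact (Nat.modEq_iff_dvd' (Nat.one_le_pow _ _ (by positivity))).1 this.symm
  have h2 : 2 ∣ tetGap a b := by
    induction b with
    | zero =>
      obtain ⟨m, rfl⟩ := ho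
      simp [tetGap, tet]
    | succ b ih => exact Dvd.dvd.trans (by norm_num) (hstep b ih)
  exact ⟨h2, hstep b h2⟩

theorem four_dvd_tetGap_of_even {a : ℕ} (ha : 1 < a) (he : 2 ∣ a) (b : ℕ) :
    4 ∣ tetGap a (b + 2) := by
  have h : ∀ b, 4 ∣ tet a (b + 2) := by
    intro b
    have h2 : 2 ≤ tet a (b + 1) := by have := succ_le_tet ha (b + 1); omega
    exact ((pow_dvd_pow_of_dvd he 2).trans (pow_dvd_pow a h2) : 2 ^ 2 ∣ _)
  exact Nat.dvd_sub (h (b + 1)) (h b)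

theorem four_dvd_tetGap {a : ℕ} (ha : 1 < a) {b : ℕ} (hb : 2 ≤ b) : 4 ∣ tetGap a b := by
  obtain ⟨c, rfl⟩ := Nat.exists_eq_add_of_le' hb
  rcases Nat.even_or_odd a with he | ho
  · exact four_dvd_tetGap_of_even ha he.two_dvd c
  · exact (dvd_tetGap_of_odd ha ho (c + 1)).2

theorem padicValNat_tetGap_succ {a p : ℕ} [hp : Fact p.Prime] (ha : 1 < a) (b : ℕ) :
    padicValNat p (tetGap a (b + 1)) =
      tet a b * padicValNat p a + padicValNat p (a ^ tetGap a b - 1) := by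
  have := one_lt_pow_tetGap ha b
  rw [tetGap_succ ha, padicValNat.mul (pow_ne_zero _ (by omega)) (by omega), padicValNat.pow]

/-- By Fermat 5 divides `a ^ 4 - 1`, so with gap `4 * k` the exponent is lifted in `(a ^ 4) ^ k -
1`; the factor 4 does not affect the valuation of the gap. -/
theorem padicValNat_five_tetGap_succ {a : ℕ} (ha : 1 < a) (h5 : ¬ 5 ∣ a) {b : ℕ} (hb : 2 ≤ b) :
    padicValNat 5 (tetGap a (b + 1)) =
      padicValNat 5 (tetGap a b) + padicValNat 5 (a ^ 4 - 1) := by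
  obtain ⟨k, hk⟩ := four_dvd_tetGap ha hb
  have hpos := tetGap_pos ha b
  have hk0 : k ≠ 0 := by rintro rfl; omega
  have h4 : 1 < a ^ 4 := Nat.one_lt_pow (by norm_num) ha
  have hd : 5 ∣ a ^ 4 - 1 := by
    have : a ^ 4 ≡ 1 [MOD 5] := by
      have := Nat.ModEq.pow_totient
        ((Nat.coprime_comm.1 ((Nat.Prime.coprime_iff_not_dvd (by norm_num)).2 h5)))
      rwa [Nat.totient_prime (by norm_num)] at this
    exact (Nat.modEq_iff_dvd' h4.le).1 this.symm
  have h5' : ¬ 5 ∣ a ^ 4 := fun h => h5 (Nat.Prime.dvd_of_dvd_pow (by norm_num) h)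
  have hl := padicValNat.pow_sub_pow (p := 5) (by decide) h4 hd h5' hk0
  rw [padicValNat_tetGap_succ ha, padicValNat.eq_zero_of_not_dvd h5, mul_zero, zero_add, hk,
    pow_mul]
  rw [one_pow] at hl
  rw [hl, padicValNat.mul (by norm_num) hk0,
    padicValNat.eq_zero_of_not_dvd (p := 5) (n := 4) (by norm_num), zero_add, add_comm]

theorem padicValNat_two_tetGap_succ {a : ℕ} (ha : 1 < a) (ho : Odd a) (b : ℕ) :
    padicValNat 2 (tetGap a (b + 1)) + 1 =
      padicValNat 2 (tetGap a b) + (padicValNat 2 (a + 1) + padicValNat 2 (a - 1)) := by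
  have h2 : ¬ 2 ∣ a := ho.not_two_dvd_nat
  have hl := padicValNat.pow_two_sub_pow ha (by obtain ⟨m, rfl⟩ := ho; simp) h2
    (tetGap_pos ha b).ne' (even_iff_two_dvd.2 (dvd_tetGap_of_odd ha ho b).1)
  rw [one_pow] at hl
  rw [padicValNat_tetGap_succ ha, padicValNat.eq_zero_of_not_dvd h2, mul_zero, zero_add, hl,
    add_comm]

/-! ### Eventually linear sequences -/

theorem eq_add_mul_of_succ {f : ℕ → ℕ} {s B : ℕ} (hf : ∀ b ≥ B, f (b + 1) = f b + s) (k : ℕ) :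
    f (B + k) = f B + s * k := by
  induction k with
  | zero => simp
  | succ k ih => rw [← add_assoc, hf _ (by omega), ih]; ring

theorem min_succ_of_le {f g : ℕ → ℕ} {s B B' : ℕ} (hf : ∀ b ≥ B, f (b + 1) = f b + s)
    (hfg : ∀ b ≥ B', f b ≤ g b) :
    ∃ C, ∀ b ≥ C, min (f (b + 1)) (g (b + 1)) = min (f b) (g b) + s := by
  refine ⟨max B B', fun b hb => ?_⟩
  rw [min_eq_left (hfg _ (by omega)), min_eq_left (hfg _ (by omega)), hf _ (by omega)]

theorem min_succ_of_lt {f g : ℕ → ℕ} {s t B : ℕ} (hf : ∀ b ≥ B, f (b + 1) = f b + s)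
    (hg : ∀ b ≥ B, g (b + 1) = g b + t) (hst : s < t) :
    ∃ C, ∀ b ≥ C, min (f (b + 1)) (g (b + 1)) = min (f b) (g b) + s := by
  -- After at least `f B` steps beyond `B`, the larger slope has made up any initial deficit, which
  -- is at most `f B`.
  refine min_succ_of_le (B' := B + f B) hf fun b hb => ?_
  obtain ⟨k, rfl⟩ := Nat.exists_eq_add_of_le (show B ≤ b by omega)
  rw [eq_add_mul_of_succ hf, eq_add_mul_of_succ hg]
  have : f B ≤ k := by omega
  nlinarith

theorem min_succ_of_linear {f g : ℕ → ℕ} {s t B : ℕ} (hf : ∀ b ≥ B, f (b + 1) = f b + s)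
    (hg : ∀ b ≥ B, g (b + 1) = g b + t) :
    ∃ C, ∀ b ≥ C, min (f (b + 1)) (g (b + 1)) = min (f b) (g b) + min s t := by
  rcases lt_trichotomy s t with h | rfl | h
  · rw [min_eq_left h.le]; exact min_succ_of_lt hf hg h
  · refine ⟨B, fun b hb => ?_⟩
    rw [hf b hb, hg b hb]; omega
  · rw [min_eq_right h.le]
    obtain ⟨C, hC⟩ := min_succ_of_lt hg hf h
    exact ⟨C, fun b hb => by rw [min_comm, hC b hb, min_comm]⟩

/-! ### The constant congruence speed -/

/-- The congruence speed of `a` is eventually constant, with value `c`. -/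
def HasConstantSpeed (a : ℕ) (c : ℤ) : Prop :=
  (∃ b, IsStableHeight a b) ∧ V a = c

theorem hasConstantSpeed_of_eventually {a : ℕ} {c : ℤ} {B : ℕ}
    (h : ∀ b ≥ B, congruenceSpeed a b = c) : HasConstantSpeed a c := by
  have hs : IsStableHeight a (B + 1) :=
    ⟨by omega, fun k => by rw [h _ (by omega), h _ (by omega)]⟩
  have hm : IsStableHeight a (optimalHeight a) :=
    Nat.sInf_mem (s := {b | IsStableHeight a b}) ⟨_, hs⟩
  -- The least stable height may lie below `B`; stability moves it up by `B`, into the range of `h`.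
  exact ⟨⟨_, hs⟩, (hm.2 B).trans (h _ (by omega))⟩

theorem hasConstantSpeed_of_min {a c : ℕ} (ha : 1 < a)
    (h : ∃ C, ∀ b ≥ C, min (padicValNat 2 (tetGap a (b + 1))) (padicValNat 5 (tetGap a (b + 1))) =
      min (padicValNat 2 (tetGap a b)) (padicValNat 5 (tetGap a b)) + c) :
    HasConstantSpeed a c := by
  obtain ⟨C, hC⟩ := h
  refine hasConstantSpeed_of_eventually (B := C + 1) fun b hb => ?_
  obtain ⟨b, rfl⟩ := Nat.exists_eq_add_of_le' (show 1 ≤ b by omega)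
  rw [congruenceSpeed, if_neg (by omega), if_neg (by omega), stableDigits_eq_min ha,
    Nat.add_sub_cancel, stableDigits_eq_min ha, hC b (by omega)]
  push_cast; ring

theorem hasConstantSpeed_zero : HasConstantSpeed 0 0 :=
  hasConstantSpeed_of_eventually (B := 0) fun b _ => by simp [congruenceSpeed]

theorem hasConstantSpeed_one : HasConstantSpeed 1 0 :=
  hasConstantSpeed_of_eventually (B := 2) fun b hb => by
    simp [congruenceSpeed, show b ≠ 1 by omega]

/-- If `p` divides `a`, then the `p`-adic valuation of the differences outgrows every
eventually linear sequence. -/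
theorem exists_le_padicValNat_tetGap {a p : ℕ} [Fact p.Prime] (ha : 1 < a) (hp : p ∣ a)
    {f : ℕ → ℕ} {s B : ℕ} (hf : ∀ b ≥ B, f (b + 1) = f b + s) :
    ∃ C, ∀ b ≥ C, f b ≤ padicValNat p (tetGap a b) := by
  -- At height `b + 1` the valuation is at least `tet a b`, while `f (b + 1) ≤ f B + s + s * b`.
  obtain ⟨C, hC⟩ := exists_linear_le_tet ha (f B + s) s
  refine ⟨B + C + 1, fun b hb => ?_⟩
  obtain ⟨b, rfl⟩ := Nat.exists_eq_add_of_le' (show 1 ≤ b by omega)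
  obtain ⟨k, hk⟩ := Nat.exists_eq_add_of_le (show B ≤ b + 1 by omega)
  have h1 : f (b + 1) ≤ f B + s + s * b := by
    rw [hk, eq_add_mul_of_succ hf]
    have : k ≤ b + 1 := by omega
    nlinarith
  have h2 : 1 ≤ padicValNat p a := one_le_padicValNat_of_dvd (by omega) hp
  rw [padicValNat_tetGap_succ ha]
  have h3 := hC b (by omega)
  have h4 := Nat.mul_le_mul_left (tet a b) h2
  omega

/-- The slope of the `2`-adic valuation of the differences, for an odd base. -/
def twoSlope (a : ℕ) : ℕ := padicValNat 2 (a + 1) + padicValNat 2 (a - 1) - 1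

theorem padicValNat_two_tetGap_succ_eq {a : ℕ} (ha : 1 < a) (ho : Odd a) (b : ℕ) :
    padicValNat 2 (tetGap a (b + 1)) = padicValNat 2 (tetGap a b) + twoSlope a := by
  have h := padicValNat_two_tetGap_succ ha ho b
  have h1 : 1 ≤ padicValNat 2 (a + 1) := one_le_padicValNat_of_dvd (by omega)
    (by obtain ⟨m, rfl⟩ := ho; omega)
  unfold twoSlope; omega

theorem hasConstantSpeed_of_coprime {a : ℕ} (ha : 1 < a) (ho : Odd a) (h5 : ¬ 5 ∣ a) :
    HasConstantSpeed a (min (twoSlope a) (padicValNat 5 (a ^ 4 - 1)) : ℕ) :=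
  hasConstantSpeed_of_min ha (min_succ_of_linear (B := 2)
    (f := fun b => padicValNat 2 (tetGap a b)) (g := fun b => padicValNat 5 (tetGap a b))
    (fun b _ => padicValNat_two_tetGap_succ_eq ha ho b)
    (fun _ hb => padicValNat_five_tetGap_succ ha h5 hb))

theorem hasConstantSpeed_of_five_dvd {a : ℕ} (ha : 1 < a) (ho : Odd a) (h5 : 5 ∣ a) :
    HasConstantSpeed a (twoSlope a) := by
  have hf : ∀ b ≥ 0, padicValNat 2 (tetGap a (b + 1)) = padicValNat 2 (tetGap a b) + twoSlope a :=
    fun b _ => padicValNat_two_tetGap_succ_eq ha ho b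
  obtain ⟨C, hC⟩ := exists_le_padicValNat_tetGap (p := 5) ha h5
    (f := fun b => padicValNat 2 (tetGap a b)) hf
  exact hasConstantSpeed_of_min ha
    (min_succ_of_le (f := fun b => padicValNat 2 (tetGap a b))
      (g := fun b => padicValNat 5 (tetGap a b)) hf hC)

theorem hasConstantSpeed_of_even {a : ℕ} (ha : 1 < a) (he : 2 ∣ a) (h5 : ¬ 5 ∣ a) :
    HasConstantSpeed a (padicValNat 5 (a ^ 4 - 1)) := by
  have hf : ∀ b ≥ 2, padicValNat 5 (tetGap a (b + 1)) =
      padicValNat 5 (tetGap a b) + padicValNat 5 (a ^ 4 - 1) :=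
    fun _ hb => padicValNat_five_tetGap_succ ha h5 hb
  obtain ⟨C, hC⟩ := exists_le_padicValNat_tetGap (p := 2) ha he
    (f := fun b => padicValNat 5 (tetGap a b)) hf
  obtain ⟨D, hD⟩ := min_succ_of_le (f := fun b => padicValNat 5 (tetGap a b))
      (g := fun b => padicValNat 2 (tetGap a b)) hf hC
  exact hasConstantSpeed_of_min ha ⟨D, fun b hb => by rw [min_comm, hD b hb, min_comm]⟩

/-- For p = 2 and p = 5 the factor a^(d_b) - 1 is prime to p, so the valuations are exact multiples
of the tower. From height 2 on the speed is a fixed positive multiple of the gap two heights lower,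
and the gaps strictly increase. -/
theorem not_isStableHeight_of_ten_dvd {a : ℕ} (ha : 1 < a) (h2 : 2 ∣ a) (h5 : 5 ∣ a) (b : ℕ) :
    ¬ IsStableHeight a b := by
  have hv : ∀ p : ℕ, [Fact p.Prime] → p ∣ a → ∀ b,
      padicValNat p (tetGap a (b + 1)) = tet a b * padicValNat p a := by
    intro p hp hpa b
    have h1 := one_lt_pow_tetGap ha b
    rw [padicValNat_tetGap_succ ha, padicValNat.eq_zero_of_not_dvd (n := _ - 1), add_zero]
    intro h
    have := (Nat.dvd_add_right h).1
      (by rw [Nat.sub_add_cancel h1.le]; exact dvd_pow hpa (tetGap_pos ha b).ne')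
    exact hp.out.one_lt.ne' (Nat.dvd_one.1 this)
  set k := min (padicValNat 2 a) (padicValNat 5 a) with hk
  have hk1 : 1 ≤ k := le_min (one_le_padicValNat_of_dvd (by omega) h2)
    (one_le_padicValNat_of_dvd (by omega) h5)
  have hs : ∀ b, stableDigits a (b + 1) = tet a b * k := by
    intro b
    rw [stableDigits_eq_min ha, hv 2 h2, hv 5 h5, hk, Nat.mul_min_mul_left]
  have hc : ∀ b, congruenceSpeed a (b + 2) = tetGap a b * k := by
    intro b
    rw [congruenceSpeed, if_neg (by omega), if_neg (by omega), hs,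
      show b + 2 - 1 = b + 1 by omega, hs, cast_tetGap ha]
    push_cast; ring
  rintro ⟨-, h⟩
  have e := (h 2).symm.trans (h 3)
  rw [show b + 3 = (b + 1) + 2 by ring, hc, hc] at e
  have e' : tetGap a b = tetGap a (b + 1) :=
    Nat.eq_of_mul_eq_mul_right hk1 (by exact_mod_cast e)
  have i1 := two_mul_tet_le ha b
  have i2 := two_mul_tet_le ha (b + 1)
  have i3 := succ_le_tet ha b
  unfold tetGap at e'
  omega

/-! ### Residues of decadic integers -/

theorem Decadic.castHom_residue (y : Decadic) {m n : ℕ} (h : m ≤ n) :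
    ZMod.castHom (pow_dvd_pow 10 h) (ZMod (10 ^ m)) (y.residue n) = y.residue m :=
  y.2 m n h

theorem Decadic.ext_residue {y z : Decadic} (h : ∀ n, y.residue n = z.residue n) : y = z :=
  Subtype.ext (funext h)

theorem Decadic.residue_eq_intCast (y : Decadic) {m n : ℕ} (h : m ≤ n) {A : ℤ}
    (hA : (A : ZMod (10 ^ n)) = y.residue n) : (A : ZMod (10 ^ m)) = y.residue m := by
  rw [← y.castHom_residue h, ← hA, map_intCast]

theorem intCast_zmod_ten_pow_eq_iff {n : ℕ} {A B : ℤ} :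
    (A : ZMod (10 ^ n)) = (B : ZMod (10 ^ n)) ↔ (10 : ℤ) ^ n ∣ A - B := by
  rw [eq_comm, ZMod.intCast_eq_intCast_iff_dvd_sub]
  push_cast; rfl

theorem ten_pow_dvd_iff {n : ℕ} {z : ℤ} : (10 : ℤ) ^ n ∣ z ↔ 2 ^ n ∣ z ∧ 5 ^ n ∣ z := by
  rw [show (10 : ℤ) = 2 * 5 by norm_num, mul_pow]
  refine ⟨fun h => ⟨(Dvd.intro _ rfl).trans h, (Dvd.intro_left _ rfl).trans h⟩, fun h => ?_⟩
  exact IsCoprime.mul_dvd (IsCoprime.pow (by norm_num [Int.isCoprime_iff_gcd_eq_one])) h.1 h.2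

/-- The residue modulo `100` in terms of the last two digits. -/
theorem Decadic.residue_two_eq (y : Decadic) :
    y.residue 2 = ((10 * y.digit 2 + y.digit 1 : ℕ) : ZMod (10 ^ 2)) := by
  have h1 : (y.residue 1).val = (y.residue 2).val % 10 := by
    rw [← y.castHom_residue (show 1 ≤ 2 by norm_num), ZMod.castHom_apply, ZMod.cast_eq_val,
      ZMod.val_natCast, pow_one]
  have h2 : 10 * y.digit 2 + y.digit 1 = (y.residue 2).val := by
    simp only [Decadic.digit, h1, show 2 - 1 = 1 by norm_num, pow_one, Nat.sub_self, pow_zero,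
      Nat.div_one]
    omega
  rw [h2, ZMod.natCast_zmod_val]

/-! ### Existence of the solutions of `y ^ 5 = y` -/

/-- Modulo `2 ^ m` both powers vanish. Modulo `5 ^ m`, the congruence of `2 ^ 5` and 2 modulo 5
gains a factor 5 with each fifth power. -/
theorem ten_pow_dvd_two_pow_sub {m k : ℕ} (h : m ≤ k) :
    (10 : ℤ) ^ m ∣ 2 ^ 5 ^ (k + 1) - 2 ^ 5 ^ k := by
  have hk : k < 5 ^ k := Nat.lt_pow_self (by norm_num)
  have hk' : 5 ^ k ≤ 5 ^ (k + 1) := Nat.pow_le_pow_right (by norm_num) (by omega)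
  rw [ten_pow_dvd_iff]
  refine ⟨dvd_sub (pow_dvd_pow _ (by omega)) (pow_dvd_pow _ (by omega)), ?_⟩
  have := dvd_sub_pow_of_dvd_sub (R := ℤ) (p := 5) (a := 2 ^ 5) (b := 2) (by norm_num) k
  rw [← pow_mul, ← pow_succ'] at this
  exact (pow_dvd_pow 5 (by omega)).trans this

theorem two_pow_residue_succ {m k : ℕ} (h : m ≤ k) :
    (2 : ZMod (10 ^ m)) ^ 5 ^ (k + 1) = 2 ^ 5 ^ k := by
  have := intCast_zmod_ten_pow_eq_iff.2 (ten_pow_dvd_two_pow_sub h)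
  push_cast at this
  exact this

theorem two_pow_residue_eq {m n : ℕ} (h : m ≤ n) :
    (2 : ZMod (10 ^ m)) ^ 5 ^ n = 2 ^ 5 ^ m := by
  induction n, h using Nat.le_induction with
  | base => rfl
  | succ k hk ih => rw [two_pow_residue_succ hk, ih]

/-- The decadic limit of `2 ^ 5 ^ n`. -/
def twoLimit : Decadic :=
  ⟨fun n => 2 ^ 5 ^ n, fun m n h => by
    rw [map_pow, map_ofNat, two_pow_residue_eq h]⟩

theorem twoLimit_pow_five : twoLimit ^ 5 = twoLimit :=
  Decadic.ext_residue fun n => by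
    change ((2 : ZMod (10 ^ n)) ^ 5 ^ n) ^ 5 = 2 ^ 5 ^ n
    rw [← pow_mul, ← pow_succ, two_pow_residue_succ le_rfl]

/-- Here `t ^ 4` is idempotent, and `t ^ (j + 1)` is orthogonal to `1 - t ^ 4`, so powers are taken
in each summand separately. For `twoLimit`, which is (0, i) in ℤ_2 × ℤ_5 with i a primitive fourth
root of unity, the element is (s, i^(j+1)); s = ±1 and j = 0, …, 3 give all eight solutions wanted.
-/
theorem pow_five_eq_self {R : Type*} [CommRing R] {t s : R} (ht : t ^ 5 = t) (hs : s ^ 2 = 1)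
    (j : ℕ) : (t ^ (j + 1) + s * (1 - t ^ 4)) ^ 5 = t ^ (j + 1) + s * (1 - t ^ 4) := by
  have huw : t ^ (j + 1) * (1 - t ^ 4) = 0 := by
    linear_combination (-t ^ j) * ht
  have hww : (1 - t ^ 4) ^ 2 = 1 - t ^ 4 := by
    linear_combination (t ^ 3) * ht
  have hu : (t ^ (j + 1)) ^ 5 = t ^ (j + 1) := by
    rw [← pow_mul, mul_comm, pow_mul, ht]
  generalize t ^ (j + 1) = u at *
  generalize 1 - t ^ 4 = w at *
  have h2 : (u + s * w) ^ 2 = u ^ 2 + w := by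
    linear_combination 2 * s * huw + s ^ 2 * hww + w * hs
  have h4 : (u + s * w) ^ 4 = u ^ 4 + w := by
    rw [show (u + s * w) ^ 4 = ((u + s * w) ^ 2) ^ 2 by ring, h2]
    linear_combination 2 * u * huw + hww
  rw [pow_succ, h4]
  linear_combination s * u ^ 3 * huw + huw + s * hww + hu

theorem exists_isAlpha {x₂ x₁ : ℕ} (h : (x₂, x₁) ∈ unitEndings) : ∃ y, IsAlpha x₂ x₁ y := by
  have p5 (s : Decadic) (hs : s ^ 2 = 1) (j : ℕ) := pow_five_eq_self twoLimit_pow_five hs j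
  have pos := p5 1 (by ring)
  have neg := p5 (-1) (by ring)
  simp only [unitEndings, Finset.mem_insert, Finset.mem_singleton, Prod.mk.injEq] at h
  rcases h with ⟨rfl, rfl⟩ | ⟨rfl, rfl⟩ | ⟨rfl, rfl⟩ | ⟨rfl, rfl⟩ | ⟨rfl, rfl⟩ | ⟨rfl, rfl⟩ |
    ⟨rfl, rfl⟩ | ⟨rfl, rfl⟩
  -- Modulo 100 the powers t, t², t³, t⁴ of `twoLimit` are 32, 24, 68, 76, and 1 - t⁴ is 25.
  · exact ⟨_, pos 3, by decide, by decide⟩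
  · exact ⟨_, neg 0, by decide, by decide⟩
  · exact ⟨_, neg 2, by decide, by decide⟩
  · exact ⟨_, pos 1, by decide, by decide⟩
  · exact ⟨_, neg 3, by decide, by decide⟩
  · exact ⟨_, pos 0, by decide, by decide⟩
  · exact ⟨_, pos 2, by decide, by decide⟩
  · exact ⟨_, neg 1, by decide, by decide⟩

/-! ### Integer approximations and uniqueness -/

/-- The cofactor of `A - B` is congruent to `4 * B ^ 3` modulo 5, hence prime to 5. This lets a
fourth root of unity be identified by its residue modulo 5. -/
theorem five_pow_dvd_pow_four_sub_iff {A B : ℤ} (h : 5 ∣ A - B) (hB : ¬ 5 ∣ B) (n : ℕ) :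
    5 ^ n ∣ A ^ 4 - B ^ 4 ↔ 5 ^ n ∣ A - B := by
  have hp : Prime (5 : ℤ) := by norm_num
  have hf : A ^ 4 - B ^ 4 = (A - B) * (A ^ 3 + A ^ 2 * B + A * B ^ 2 + B ^ 3) := by ring
  have hS : ¬ (5 : ℤ) ∣ A ^ 3 + A ^ 2 * B + A * B ^ 2 + B ^ 3 := by
    intro hS
    obtain ⟨k, hk⟩ := h
    obtain rfl : A = B + 5 * k := by linarith
    have : (5 : ℤ) ∣ 4 * B ^ 3 := by
      refine (Int.dvd_add_right (Dvd.intro (6 * B ^ 2 * k + 20 * B * k ^ 2 + 25 * k ^ 3) rfl)).1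
        (?_ : (5 : ℤ) ∣ 5 * (6 * B ^ 2 * k + 20 * B * k ^ 2 + 25 * k ^ 3) + 4 * B ^ 3)
      convert hS using 1; ring
    rcases hp.dvd_or_dvd this with h | h
    · norm_num at h
    · exact hB (hp.dvd_of_dvd_pow h)
  rw [hf]
  refine ⟨fun h => ?_, fun h => h.mul_right _⟩
  exact (IsCoprime.pow_left ((Prime.coprime_iff_not_dvd hp).2 hS)).dvd_of_dvd_mul_right h

/-- A unit solution of `y ^ 5 = y` is approximated modulo `10 ^ n` by an integer that is `ε = ±1`
modulo `2 ^ n` and a fourth root of unity modulo `5 ^ n`. -/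
theorem IsAlpha.exists_approx {x₂ x₁ : ℕ} {y : Decadic} (hy : IsAlpha x₂ x₁ y)
    (hx : Nat.Coprime x₁ 10) {ε : ℤ} (hε : ε = 1 ∨ ε = -1)
    (h4 : 4 ∣ ((10 * x₂ + x₁ : ℕ) : ℤ) - ε) (n : ℕ) :
    ∃ A : ℤ, (A : ZMod (10 ^ n)) = y.residue n ∧ 100 ∣ A - ((10 * x₂ + x₁ : ℕ) : ℤ) ∧
      2 ^ n ∣ A - ε ∧ 5 ^ n ∣ A ^ 4 - 1 ∧ ¬ 5 ∣ A := by
  obtain ⟨h5, hd1, hd2⟩ := hy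
  -- The two extra digits fix `A` modulo 100 for every `n`, and pay for the factor 4 lost in passing
  -- from `A ^ 4 - 1` to `A - ε`.
  set A : ℤ := ((y.residue (n + 2)).val : ℤ) with hA
  have hr : (A : ZMod (10 ^ (n + 2))) = y.residue (n + 2) := by
    rw [hA, Int.cast_natCast, ZMod.natCast_zmod_val]
  have h100 : (100 : ℤ) ∣ A - ((10 * x₂ + x₁ : ℕ) : ℤ) := by
    have := y.residue_eq_intCast (show 2 ≤ n + 2 by omega) hr
    rw [y.residue_two_eq, hd1, hd2, ← Int.cast_natCast, intCast_zmod_ten_pow_eq_iff] at this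
    simpa using this
  have h10 : IsCoprime A 10 := by
    obtain ⟨k, hk⟩ := h100
    have e : A = (x₁ : ℤ) + 10 * (10 * k + x₂) := by push_cast at hk; linarith
    rw [e, IsCoprime.add_mul_left_left_iff]
    exact Nat.isCoprime_iff_coprime.2 hx
  have h4' : (10 : ℤ) ^ (n + 2) ∣ A ^ 4 - 1 := by
    have e : (y.residue (n + 2)) ^ 5 = y.residue (n + 2) :=
      congrArg (fun z : Decadic => z.residue (n + 2)) h5
    rw [← hr, ← Int.cast_pow, intCast_zmod_ten_pow_eq_iff,
      show A ^ 5 - A = A * (A ^ 4 - 1) by ring] at e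
    exact (IsCoprime.pow_left h10.symm).dvd_of_dvd_mul_left e
  have hA4 : 4 ∣ A - ε := by omega
  have hA5 : ¬ (5 : ℤ) ∣ A := by
    intro h
    have := h10.isUnit_of_dvd' h (by norm_num)
    norm_num [Int.isUnit_iff] at this
  rw [ten_pow_dvd_iff] at h4'
  refine ⟨A, y.residue_eq_intCast (by omega) hr, h100, ?_,
    (pow_dvd_pow _ (by omega)).trans h4'.2, hA5⟩
  clear_value A
  obtain ⟨k, hk⟩ := hA4
  obtain rfl | rfl := hε <;> obtain ⟨m, hm⟩ := h4'.1
  -- With `A = ε + 4 * k`, the number `A ^ 4 - 1` is `4 * (A - ε)` times an odd number.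
  · obtain rfl : A = 1 + 4 * k := by linarith
    have hodd : IsCoprime ((2 : ℤ) ^ n) (2 * (8 * k ^ 3 + 8 * k ^ 2 + 3 * k) + 1) :=
      IsCoprime.pow_left ⟨-(8 * k ^ 3 + 8 * k ^ 2 + 3 * k), 1, by ring⟩
    refine hodd.dvd_of_dvd_mul_right ⟨m, mul_left_cancel₀ (four_ne_zero (α := ℤ)) ?_⟩
    rw [pow_add] at hm
    linear_combination hm
  · obtain rfl : A = -1 + 4 * k := by linarith
    have hodd : IsCoprime ((2 : ℤ) ^ n) (2 * (8 * k ^ 3 - 8 * k ^ 2 + 3 * k - 1) + 1) :=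
      IsCoprime.pow_left ⟨-(8 * k ^ 3 - 8 * k ^ 2 + 3 * k - 1), 1, by ring⟩
    refine hodd.dvd_of_dvd_mul_right ⟨m, mul_left_cancel₀ (four_ne_zero (α := ℤ)) ?_⟩
    rw [pow_add] at hm
    linear_combination hm

theorem exists_sign_of_coprime_ten {x₂ x₁ : ℕ} (hx : Nat.Coprime x₁ 10) :
    ∃ ε : ℤ, (ε = 1 ∨ ε = -1) ∧ 4 ∣ ((10 * x₂ + x₁ : ℕ) : ℤ) - ε := by
  have h : ¬ 2 ∣ x₁ := fun h => by simpa using Nat.dvd_gcd h (show 2 ∣ 10 by norm_num) |>.trans hx.dvd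
  rcases (by omega : (10 * x₂ + x₁) % 4 = 1 ∨ (10 * x₂ + x₁) % 4 = 3) with h | h
  · exact ⟨1, Or.inl rfl, by omega⟩
  · exact ⟨-1, Or.inr rfl, by omega⟩

/-- The last two digits determine the sign modulo 4 and the residue modulo 5, and these determine
the solution modulo every power of 2 and of 5. -/
theorem IsAlpha.unique {x₂ x₁ : ℕ} {y z : Decadic} (hx : Nat.Coprime x₁ 10)
    (hy : IsAlpha x₂ x₁ y) (hz : IsAlpha x₂ x₁ z) : y = z := by
  obtain ⟨ε, hε, h4⟩ := exists_sign_of_coprime_ten (x₂ := x₂) hx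
  refine Decadic.ext_residue fun n => ?_
  obtain ⟨A, hA, hA100, hA2, hA5, -⟩ := hy.exists_approx hx hε h4 n
  obtain ⟨B, hB, hB100, hB2, hB5, hB0⟩ := hz.exists_approx hx hε h4 n
  rw [← hA, ← hB, intCast_zmod_ten_pow_eq_iff, ten_pow_dvd_iff,
    ← five_pow_dvd_pow_four_sub_iff (by omega) hB0]
  exact ⟨by simpa using dvd_sub hA2 hB2, by simpa using dvd_sub hA5 hB5⟩

theorem coprime_ten_of_mem_unitEndings {x₂ x₁ : ℕ} (h : (x₂, x₁) ∈ unitEndings) :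
    Nat.Coprime x₁ 10 := by
  revert h
  simp only [unitEndings, Finset.mem_insert, Finset.mem_singleton, Prod.mk.injEq]
  rintro (⟨-, rfl⟩ | ⟨-, rfl⟩ | ⟨-, rfl⟩ | ⟨-, rfl⟩ | ⟨-, rfl⟩ | ⟨-, rfl⟩ | ⟨-, rfl⟩ | ⟨-, rfl⟩) <;>
    norm_num

theorem isAlpha_alpha {x₂ x₁ : ℕ} (h : (x₂, x₁) ∈ unitEndings) :
    IsAlpha x₂ x₁ (alpha x₂ x₁) := by
  rw [alpha, dif_pos (exists_isAlpha h)]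
  exact (exists_isAlpha h).choose_spec

theorem existsUnique_isAlpha {x₂ x₁ : ℕ} (h : (x₂, x₁) ∈ unitEndings) :
    ∃! y, IsAlpha x₂ x₁ y :=
  ⟨_, isAlpha_alpha h, fun _ hy =>
    hy.unique (coprime_ten_of_mem_unitEndings h) (isAlpha_alpha h)⟩

theorem alpha_zero_one : alpha 0 1 = 1 :=
  (isAlpha_alpha (by decide)).unique (by norm_num) ⟨one_pow 5, by decide, by decide⟩

theorem alpha_nine_nine : alpha 9 9 = -1 :=
  (isAlpha_alpha (by decide)).unique (by norm_num) ⟨by ring, by decide, by decide⟩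

theorem digit_alpha_zero_one {l : ℕ} (hl : 2 ≤ l) : (alpha 0 1).digit l = 0 := by
  rw [alpha_zero_one]
  change (1 : ZMod (10 ^ l)).val / _ = 0
  have h : 1 < 10 ^ (l - 1) := Nat.one_lt_pow (by omega) (by norm_num)
  rw [← Nat.cast_one, ZMod.val_natCast]
  exact Nat.div_eq_of_lt ((Nat.mod_le _ _).trans_lt h)

theorem digit_alpha_nine_nine {l : ℕ} (hl : 2 ≤ l) : (alpha 9 9).digit l = 9 := by
  obtain ⟨k, rfl⟩ := Nat.exists_eq_add_of_le' (show 1 ≤ l by omega)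
  rw [alpha_nine_nine]
  change (-1 : ZMod (10 ^ (k + 1))).val / 10 ^ k = 9
  have hp : 0 < 10 ^ k := by positivity
  have hs : 10 ^ (k + 1) = 10 * 10 ^ k := pow_succ' 10 k
  have h : (-1 : ZMod (10 ^ (k + 1))) = ((10 ^ (k + 1) - 1 : ℕ) : ZMod (10 ^ (k + 1))) := by
    rw [Nat.cast_sub (by omega), ZMod.natCast_self]; simp
  rw [h, ZMod.val_natCast, Nat.mod_eq_of_lt (by omega), Nat.div_eq_iff hp]
  omega

/-! ### The key digit -/

theorem Decadic.natCast_eq_residue_of_le (y : Decadic) {a m n : ℕ} (h : m ≤ n)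
    (ha : (a : ZMod (10 ^ n)) = y.residue n) : (a : ZMod (10 ^ m)) = y.residue m := by
  rw [← y.castHom_residue h, ← ha, map_natCast]

/-- Otherwise every power of 10 would divide `a ^ 5 - a`, which is positive and less than `10 ^ (a ^
5)`. -/
theorem exists_ne_residue {y : Decadic} (hy : y ^ 5 = y) {a : ℕ} (ha : 1 < a) :
    ∃ n, (a : ZMod (10 ^ n)) ≠ y.residue n := by
  by_contra! h
  have e : ∀ n, (10 : ℤ) ^ n ∣ (a : ℤ) ^ 5 - a := by
    intro n
    rw [← intCast_zmod_ten_pow_eq_iff]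
    push_cast
    rw [h n]
    exact congrArg (fun z : Decadic => z.residue n) hy
  have h1 : a < a ^ 5 := by
    simpa using Nat.pow_lt_pow_right ha (show 1 < 5 by norm_num)
  have h2 := Int.le_of_dvd (by have : (a : ℤ) < a ^ 5 := by exact_mod_cast h1
                               linarith) (e (a ^ 5))
  have h3 : (a : ℤ) ^ 5 < 10 ^ (a ^ 5) := by
    exact_mod_cast (Nat.lt_pow_self (show 1 < 10 by norm_num) : a ^ 5 < 10 ^ (a ^ 5))
  have h4 : (0 : ℤ) ≤ a := by positivity
  linarith

theorem natCast_eq_residue_one {y : Decadic} {a : ℕ} (h : digit a 1 = y.digit 1) :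
    (a : ZMod (10 ^ 1)) = y.residue 1 := by
  rw [← ZMod.natCast_zmod_val (y.residue 1), ZMod.natCast_eq_natCast_iff']
  have : (y.residue 1).val < 10 ^ 1 := ZMod.val_lt _
  simp only [digit, Decadic.digit, Nat.sub_self, pow_zero, Nat.div_one] at h
  omega

theorem ten_mul_digit_two_add (a : ℕ) : 10 * digit a 2 + digit a 1 = a % 100 := by
  simp only [digit, show 2 - 1 = 1 by norm_num, pow_one, Nat.sub_self, pow_zero, Nat.div_one]
  omega

theorem natCast_eq_residue_two {y : Decadic} {a : ℕ} (h1 : digit a 1 = y.digit 1)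
    (h2 : digit a 2 = y.digit 2) : (a : ZMod (10 ^ 2)) = y.residue 2 := by
  rw [y.residue_two_eq, ← h1, ← h2, ten_mul_digit_two_add, ZMod.natCast_eq_natCast_iff']
  norm_num

theorem exists_isKeyIndex {y : Decadic} (hy : y ^ 5 = y) {a : ℕ} (ha : 1 < a)
    (h1 : digit a 1 = y.digit 1) : ∃ l, IsKeyIndex y a l := by
  classical
  have hex := exists_ne_residue hy ha
  have hs := Nat.find_spec hex
  have hl : 2 ≤ Nat.find hex := by
    by_contra! h
    exact hs (y.natCast_eq_residue_of_le (show Nat.find hex ≤ 1 by omega)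
      (natCast_eq_residue_one h1))
  exact ⟨Nat.find hex, hl, not_not.1 (Nat.find_min hex (by omega)), hs⟩

theorem isKeyIndex_keyIndex {x₂ x₁ a : ℕ} (hx : (x₂, x₁) ∈ unitEndings) (ha : 1 < a)
    (h1 : digit a 1 = x₁) : IsKeyIndex (alpha x₂ x₁) a (keyIndex x₂ x₁ a) :=
  Nat.sInf_mem (s := {l | IsKeyIndex (alpha x₂ x₁) a l})
    (exists_isKeyIndex (isAlpha_alpha hx).1 ha (h1.trans (isAlpha_alpha hx).2.1.symm))

theorem three_le_keyIndex {x₂ x₁ a : ℕ} (hx : (x₂, x₁) ∈ unitEndings) (ha : 1 < a)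
    (h1 : digit a 1 = x₁) (h2 : digit a 2 = x₂) : 3 ≤ keyIndex x₂ x₁ a := by
  obtain ⟨-, -, h⟩ := isKeyIndex_keyIndex hx ha h1
  by_contra! hl
  obtain ⟨-, d1, d2⟩ := isAlpha_alpha hx
  exact h ((alpha x₂ x₁).natCast_eq_residue_of_le (show keyIndex x₂ x₁ a ≤ 2 by omega)
    (natCast_eq_residue_two (h1.trans d1.symm) (h2.trans d2.symm)))

/-- The key digit of `a` differs from the corresponding digit of `y` by `5` exactly if the
first nonzero digit of the difference is divisible by `5`. -/
theorem abs_digit_sub_eq_five_iff {y : Decadic} {a l : ℕ} (h : IsKeyIndex y a l) {A : ℤ}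
    (hA : (A : ZMod (10 ^ l)) = y.residue l) :
    |(digit a l : ℤ) - (y.digit l : ℤ)| = 5 ↔ (10 : ℤ) ^ (l - 1) * 5 ∣ a - A := by
  obtain ⟨hl, he, hne⟩ := h
  obtain ⟨k, rfl⟩ := Nat.exists_eq_add_of_le' (show 1 ≤ l by omega)
  rw [Nat.add_sub_cancel] at *
  simp only [digit, Decadic.digit, Nat.add_sub_cancel]
  set B := (y.residue (k + 1)).val with hB
  have hBr : ((B : ℤ) : ZMod (10 ^ (k + 1))) = y.residue (k + 1) := by
    rw [hB, Int.cast_natCast, ZMod.natCast_zmod_val]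
  have hBlt : B < 10 ^ (k + 1) := ZMod.val_lt _
  have hp : 0 < 10 ^ k := by positivity
  have hBa : (10 : ℤ) ^ k ∣ a - B := by
    rw [← intCast_zmod_ten_pow_eq_iff, Int.cast_natCast, he,
      y.residue_eq_intCast (show k ≤ k + 1 by omega) hBr]
  have hBa' : ¬ (10 : ℤ) ^ (k + 1) ∣ a - B := by
    rwa [← intCast_zmod_ten_pow_eq_iff, Int.cast_natCast, hBr]
  have hAB : (10 : ℤ) ^ (k + 1) ∣ B - A := by
    rw [← intCast_zmod_ten_pow_eq_iff, hBr, hA]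
  have hmod : a % 10 ^ k = B % 10 ^ k := by
    have := (Nat.modEq_iff_dvd (n := 10 ^ k) (a := B) (b := a)).2 (by exact_mod_cast hBa)
    exact this.symm
  have hq : B / 10 ^ k < 10 := Nat.div_lt_of_lt_mul (by rwa [pow_succ] at hBlt)
  have ea := Nat.div_add_mod a (10 ^ k)
  have eB := Nat.div_add_mod B (10 ^ k)
  generalize a / 10 ^ k = q at *
  generalize B / 10 ^ k = q' at *
  have hd : (a : ℤ) - B = 10 ^ k * ((q : ℤ) - q') := by
    rw [← ea, ← eB, hmod]; push_cast; ring
  have hp' : (10 : ℤ) ^ k ≠ 0 := by positivity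
  have h1 : ¬ (10 : ℤ) ∣ (q : ℤ) - q' := by
    rwa [hd, pow_succ, mul_dvd_mul_iff_left hp'] at hBa'
  have h2 : (10 : ℤ) ^ k * 5 ∣ a - A ↔ (5 : ℤ) ∣ (q : ℤ) - q' := by
    have hdvd : (10 : ℤ) ^ k * 5 ∣ B - A :=
      Dvd.dvd.trans (by rw [pow_succ]; exact mul_dvd_mul_left _ (by norm_num)) hAB
    -- Replacing `A` by the canonical representative `B` changes the difference by a multiple of `10
    -- ^ (k + 1)`, which the divisibility does not see.
    rw [show (a : ℤ) - A = (a - B) + (B - A) by ring, Int.dvd_add_left hdvd, hd,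
      mul_dvd_mul_iff_left hp']
  -- The digits `q % 10` and `q'` differ by less than 10 and are distinct by `h1`, so 5 divides
  -- their difference only if it is ±5.
  rw [h2, abs_eq (by norm_num)]
  omega

/-! ### The constant congruence speed in terms of the key digit -/

theorem padicValInt_eq_of_dvd_of_not_dvd {p : ℕ} [Fact p.Prime] {z : ℤ} {n : ℕ}
    (h1 : (p : ℤ) ^ n ∣ z) (h2 : ¬ (p : ℤ) ^ (n + 1) ∣ z) : padicValInt p z = n := by
  rw [padicValInt_dvd_iff] at h1 h2
  push Not at h2
  rcases h1 with h | h
  · exact absurd h h2.1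
  · omega

theorem padicValNat_pow_four_sub_one_eq {a : ℕ} (ha : 1 < a) :
    padicValNat 5 (a ^ 4 - 1) = padicValInt 5 ((a : ℤ) ^ 4 - 1) := by
  have h : 1 ≤ a ^ 4 := Nat.one_le_pow _ _ (by omega)
  rw [← padicValInt.of_nat, Nat.cast_sub h]; push_cast; rfl

/-- The neighbour `a + ε` is 2 modulo 4; its valuation 1 cancels the `- 1` in `twoSlope`. -/
theorem twoSlope_eq {a : ℕ} (ha : 1 < a) {ε : ℤ} (hε : ε = 1 ∨ ε = -1) (h4 : 4 ∣ (a : ℤ) - ε) :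
    twoSlope a = padicValInt 2 ((a : ℤ) - ε) := by
  rcases hε with rfl | rfl
  · have h1 : padicValNat 2 (a + 1) = 1 := by
      rw [← padicValInt.of_nat]
      exact padicValInt_eq_of_dvd_of_not_dvd (by push_cast; omega) (by push_cast; omega)
    rw [twoSlope, h1, Nat.add_sub_cancel_left, ← padicValInt.of_nat, Nat.cast_sub ha.le]
    rfl
  · have h1 : padicValNat 2 (a - 1) = 1 := by
      rw [← padicValInt.of_nat, Nat.cast_sub ha.le]
      exact padicValInt_eq_of_dvd_of_not_dvd (by push_cast; omega) (by push_cast; omega)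
    rw [twoSlope, h1, Nat.add_sub_cancel, ← padicValInt.of_nat, sub_neg_eq_add]
    push_cast; rfl

/-- Comparison of the two slopes by means of the key digit. -/
theorem padicValInt_compare {x₂ x₁ a l : ℕ} {y : Decadic} (ha : 1 < a) (hy : IsAlpha x₂ x₁ y)
    (hx : Nat.Coprime x₁ 10) {ε : ℤ} (hε : ε = 1 ∨ ε = -1)
    (h4 : 4 ∣ ((10 * x₂ + x₁ : ℕ) : ℤ) - ε) (h : IsKeyIndex y a l) :
    (|(digit a l : ℤ) - (y.digit l : ℤ)| ≠ 5 →
      padicValInt 5 ((a : ℤ) ^ 4 - 1) ≤ padicValInt 2 ((a : ℤ) - ε)) ∧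
    (|(digit a l : ℤ) - (y.digit l : ℤ)| = 5 →
      padicValInt 2 ((a : ℤ) - ε) ≤ padicValInt 5 ((a : ℤ) ^ 4 - 1)) := by
  obtain ⟨A, hA, -, hA2, hA5, hA0⟩ := hy.exists_approx hx hε h4 l
  rw [ne_eq, abs_digit_sub_eq_five_iff h hA]
  obtain ⟨hl, he, hne⟩ := h
  obtain ⟨k, rfl⟩ := Nat.exists_eq_add_of_le' (show 1 ≤ l by omega)
  rw [Nat.add_sub_cancel] at *
  rw [← y.residue_eq_intCast (show k ≤ k + 1 by omega) hA, ← Int.cast_natCast,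
    intCast_zmod_ten_pow_eq_iff] at he
  rw [← hA, ← Int.cast_natCast, ne_eq, intCast_zmod_ten_pow_eq_iff] at hne
  have ha4 : (a : ℤ) ^ 4 - 1 ≠ 0 := by
    have : 1 < a ^ 4 := Nat.one_lt_pow (by norm_num) ha
    have : (1 : ℤ) < (a : ℤ) ^ 4 := by exact_mod_cast this
    omega
  have haε : (a : ℤ) - ε ≠ 0 := by omega
  have hAa5 : (5 : ℤ) ∣ a - A :=
    (Dvd.dvd.trans (by norm_num) (dvd_pow_self (10 : ℤ) (by omega : k ≠ 0))).trans he
  -- Up to exponent `k + 1`, which is the key index, both slopes can be read off from the single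
  -- difference `a - A`.
  have v5 : ∀ j ≤ k + 1, (5 : ℤ) ^ j ∣ a ^ 4 - 1 ↔ (5 : ℤ) ^ j ∣ a - A := by
    intro j hj
    rw [← five_pow_dvd_pow_four_sub_iff hAa5 hA0,
      show (a : ℤ) ^ 4 - 1 = (a ^ 4 - A ^ 4) + (A ^ 4 - 1) by ring]
    exact Int.dvd_add_left ((pow_dvd_pow _ hj).trans hA5)
  have v2 : ∀ j ≤ k + 1, (2 : ℤ) ^ j ∣ a - ε ↔ (2 : ℤ) ^ j ∣ a - A := by
    intro j hj
    rw [show (a : ℤ) - ε = (a - A) + (A - ε) by ring]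
    exact Int.dvd_add_left ((pow_dvd_pow _ hj).trans hA2)
  have w5 : ∀ j, (5 : ℤ) ^ j ∣ (a : ℤ) ^ 4 - 1 ↔ j ≤ padicValInt 5 ((a : ℤ) ^ 4 - 1) := by
    intro j
    have := padicValInt_dvd_iff (p := 5) j ((a : ℤ) ^ 4 - 1)
    simpa [ha4] using this
  have w2 : ∀ j, (2 : ℤ) ^ j ∣ (a : ℤ) - ε ↔ j ≤ padicValInt 2 ((a : ℤ) - ε) := by
    intro j
    have := padicValInt_dvd_iff (p := 2) j ((a : ℤ) - ε)
    simpa [haε] using this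
  have d := ten_pow_dvd_iff.1 he
  have e5 := (w5 k).1 ((v5 k (by omega)).2 d.2)
  have e2 := (w2 k).1 ((v2 k (by omega)).2 d.1)
  have hgap : (10 : ℤ) ^ k * 5 ∣ a - A ↔ (5 : ℤ) ^ (k + 1) ∣ a - A := by
    rw [show (10 : ℤ) ^ k * 5 = 2 ^ k * 5 ^ (k + 1) by
      rw [show (10 : ℤ) = 2 * 5 by norm_num, mul_pow]; ring]
    refine ⟨fun h => (Dvd.intro_left _ rfl).trans h, fun h => IsCoprime.mul_dvd
      (IsCoprime.pow (by norm_num [Int.isCoprime_iff_gcd_eq_one])) d.1 h⟩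
  -- Both valuations are at least `k`, and by `hne` not both exceed `k`. A digit gap of 5 says that
  -- the valuation at 5 exceeds `k`, so the one at 2 equals `k`; without it the one at 5 equals `k`.
  rw [hgap, ← v5 _ le_rfl, w5]
  rw [ten_pow_dvd_iff, ← v5 _ le_rfl, ← v2 _ le_rfl, w5, w2] at hne
  omega

/-- Only `a` modulo 20 matters: modulo 4 it fixes the sign `ε`, and modulo 10 the last digit, which
is enough for a key index to exist. Hence the same lemma serves two-digit endings and classes modulo
20. -/
theorem V_of_keyGap {x₂ x₁ a : ℕ} (hx : (x₂, x₁) ∈ unitEndings) (ha : 1 < a)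
    (hax : a % 20 = (10 * x₂ + x₁) % 20) {ε : ℤ} (hε : ε = 1 ∨ ε = -1)
    (h4 : 4 ∣ ((10 * x₂ + x₁ : ℕ) : ℤ) - ε) :
    (keyGap x₂ x₁ a ≠ 5 → V a = v 5 ((a : ℤ) ^ 4 - 1)) ∧
    (keyGap x₂ x₁ a = 5 → V a = v 2 ((a : ℤ) - ε)) := by
  have hc := coprime_ten_of_mem_unitEndings hx
  have h10 : x₁ < 10 := by
    have h : ∀ q ∈ unitEndings, q.2 < 10 := by decide
    exact h _ hx
  have h2 : ¬ 2 ∣ x₁ := fun h => Nat.not_coprime_of_dvd_of_dvd (by norm_num) h (by norm_num) hc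
  have h5 : ¬ 5 ∣ x₁ := fun h => Nat.not_coprime_of_dvd_of_dvd (by norm_num) h (by norm_num) hc
  have hd : digit a 1 = x₁ := by simp [digit]; omega
  have h4a : 4 ∣ (a : ℤ) - ε := by omega
  have hV := (hasConstantSpeed_of_coprime ha (Nat.odd_iff.2 (by omega)) (by omega)).2
  rw [twoSlope_eq ha hε h4a, padicValNat_pow_four_sub_one_eq ha] at hV
  have hk := padicValInt_compare ha (isAlpha_alpha hx) hc hε h4 (isKeyIndex_keyIndex hx ha hd)
  exact ⟨fun h => by rw [hV, min_eq_right (hk.1 h)], fun h => by rw [hV, min_eq_left (hk.2 h)]⟩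

theorem padicValInt_mul_of_not_dvd {p : ℕ} [Fact p.Prime] {y z : ℤ} (h : ¬ (p : ℤ) ∣ z) :
    padicValInt p (y * z) = padicValInt p y := by
  by_cases hy : y = 0
  · simp [hy]
  · rw [padicValInt.mul hy (by rintro rfl; exact h (dvd_zero _)),
      padicValInt.eq_zero_of_not_dvd h, add_zero]

theorem not_five_dvd_of_emod {z : ℤ} (h : z % 5 ≠ 0) : ¬ ((5 : ℕ) : ℤ) ∣ z :=
  fun hd => h (Int.emod_eq_zero_of_dvd hd)

/-- Of the factors a - 1, a + 1, a² + 1 of a⁴ - 1, only one is divisible by 5; which one depends on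
a modulo 5. -/
theorem v_five_of_mod_one {a : ℕ} (h : a % 5 = 1) :
    v 5 ((a : ℤ) ^ 4 - 1) = v 5 ((a : ℤ) - 1) := by
  have e : (a : ℤ) % 5 = 1 := by omega
  rw [v, show (a : ℤ) ^ 4 - 1 = (a - 1) * ((a + 1) * (a ^ 2 + 1)) by ring,
    padicValInt_mul_of_not_dvd (not_five_dvd_of_emod _)]
  simp [pow_two, Int.mul_emod, Int.add_emod, e]

theorem v_five_of_mod_four {a : ℕ} (h : a % 5 = 4) :
    v 5 ((a : ℤ) ^ 4 - 1) = v 5 ((a : ℤ) + 1) := by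
  have e : (a : ℤ) % 5 = 4 := by omega
  rw [v, show (a : ℤ) ^ 4 - 1 = (a + 1) * ((a - 1) * (a ^ 2 + 1)) by ring,
    padicValInt_mul_of_not_dvd (not_five_dvd_of_emod _)]
  simp [pow_two, Int.mul_emod, Int.add_emod, Int.sub_emod, e]

theorem v_five_of_mod_two_three {a : ℕ} (h : a % 5 = 2 ∨ a % 5 = 3) :
    v 5 ((a : ℤ) ^ 4 - 1) = v 5 ((a : ℤ) ^ 2 + 1) := by
  have e : (a : ℤ) % 5 = 2 ∨ (a : ℤ) % 5 = 3 := by omega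
  rw [v, show (a : ℤ) ^ 4 - 1 = (a ^ 2 + 1) * ((a - 1) * (a + 1)) by ring,
    padicValInt_mul_of_not_dvd (not_five_dvd_of_emod _)]
  rcases e with e | e <;> simp [Int.mul_emod, Int.add_emod, Int.sub_emod, e]

theorem keyGap_zero_one_eq_five_iff {a : ℕ} (ha : 1 < a) (h : a % 20 = 1) :
    keyGap 0 1 a = 5 ↔ keyDigit 0 1 a = 5 := by
  have hl := (isKeyIndex_keyIndex (x₂ := 0) (x₁ := 1) (by decide) ha
    (by simp [digit]; omega)).1
  rw [keyGap, digit_alpha_zero_one hl, abs_eq (by norm_num)]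
  omega

/-- All digits of -1 are 9, and of the numbers 4 and 14 at distance 5 from 9 only 4 is a digit. -/
theorem keyGap_nine_nine_eq_five_iff {a : ℕ} (ha : 1 < a) (h : a % 20 = 19) :
    keyGap 9 9 a = 5 ↔ keyDigit 9 9 a = 4 := by
  have hl := (isKeyIndex_keyIndex (x₂ := 9) (x₁ := 9) (by decide) ha
    (by simp [digit]; omega)).1
  have : keyDigit 9 9 a < 10 := Nat.mod_lt _ (by norm_num)
  rw [keyGap, digit_alpha_nine_nine hl, abs_eq (by norm_num)]
  omega

/-- Since `alpha 0 1 = 1`, the base 1 has no key index. The default `sInf ∅ = 0` and the truncated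
`0 - 1 = 0` give the digit 1, so base 1 never falls under the case of key digit 5. -/
theorem keyDigit_zero_one_one : keyDigit 0 1 1 = 1 := by
  have : {l | IsKeyIndex (alpha 0 1) 1 l} = ∅ := by
    ext l
    simp only [Set.mem_ofPred_eq, Set.mem_empty_iff_false, iff_false, alpha_zero_one]
    rintro ⟨-, -, h⟩
    exact h Nat.cast_one
  rw [keyDigit, keyIndex, this, Nat.sInf_empty]
  rfl

theorem V_of_not_mem_unitEndings {a : ℕ} (ha : 1 < a) (hc : Nat.Coprime a 10)
    (h : (digit a 2, digit a 1) ∉ unitEndings) : V a = 1 := by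
  have h2 : ¬ 2 ∣ a := fun h => Nat.not_coprime_of_dvd_of_dvd (by norm_num) h (by norm_num) hc
  have h5 : ¬ 5 ∣ a := fun h => Nat.not_coprime_of_dvd_of_dvd (by norm_num) h (by norm_num) hc
  obtain ⟨ε, hε, h4⟩ : ∃ ε : ℤ, (ε = 1 ∨ ε = -1) ∧ 4 ∣ (a : ℤ) - ε := by
    rcases (by omega : a % 4 = 1 ∨ a % 4 = 3) with h | h
    · exact ⟨1, Or.inl rfl, by omega⟩
    · exact ⟨-1, Or.inr rfl, by omega⟩
  have hV := (hasConstantSpeed_of_coprime ha (Nat.odd_iff.2 (by omega)) h5).2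
  have hs : 2 ≤ twoSlope a := by
    rw [twoSlope_eq ha hε h4]
    have := (padicValInt_dvd_iff (p := 2) 2 ((a : ℤ) - ε)).1 (by simpa using h4)
    omega
  -- The eight endings are exactly the units modulo 100 whose fourth power is 1 modulo 25. For all
  -- other units the slope at 5 is 1, below the slope at 2, which is at least 2.
  have key : ∀ r ∈ Finset.range 100, r % 2 = 0 ∨ r % 5 = 0 ∨ (r / 10, r % 10) ∈ unitEndings ∨
      (r ^ 4 % 5 = 1 ∧ r ^ 4 % 25 ≠ 1) := by decide
  have hdig := ten_mul_digit_two_add a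
  have hd1 : digit a 1 < 10 := Nat.mod_lt _ (by norm_num)
  have hmem : (a % 100 / 10, a % 100 % 10) ∉ unitEndings := by
    rwa [← hdig, show (10 * digit a 2 + digit a 1) / 10 = digit a 2 by omega,
      show (10 * digit a 2 + digit a 1) % 10 = digit a 1 by omega]
  have hr := (((key (a % 100) (Finset.mem_range.2 (Nat.mod_lt _ (by norm_num)))).resolve_left
    (by omega)).resolve_left (by omega)).resolve_left hmem
  have hm5 : a ^ 4 % 5 = 1 := by
    rw [← hr.1, Nat.pow_mod, Nat.pow_mod (a % 100), Nat.mod_mod_of_dvd _ (by norm_num)]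
  have hm25 : a ^ 4 % 25 ≠ 1 := by
    rw [Nat.pow_mod, ← Nat.mod_mod_of_dvd a (show 25 ∣ 100 by norm_num), ← Nat.pow_mod]
    exact hr.2
  have hv : padicValInt 5 ((a : ℤ) ^ 4 - 1) = 1 := by
    have hc : (a : ℤ) ^ 4 = (a ^ 4 : ℕ) := by push_cast; rfl
    rw [hc]
    exact padicValInt_eq_of_dvd_of_not_dvd (by norm_num only; omega) (by norm_num only; omega)
  rw [padicValNat_pow_four_sub_one_eq ha, hv, min_eq_right (by omega)] at hV
  exact hV

theorem V_of_even {a : ℕ} (h2 : a % 2 = 0) (h5 : a % 5 ≠ 0) : V a = v 5 ((a : ℤ) ^ 4 - 1) := by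
  rw [(hasConstantSpeed_of_even (by omega) (by omega) (by omega)).2,
    padicValNat_pow_four_sub_one_eq (by omega)]

theorem V_of_five_dvd {a : ℕ} (h5 : a % 5 = 0) {ε : ℤ} (hε : ε = 1 ∨ ε = -1)
    (h4 : 4 ∣ (a : ℤ) - ε) : V a = v 2 ((a : ℤ) - ε) := by
  rw [(hasConstantSpeed_of_five_dvd (by omega) (Nat.odd_iff.2 (by omega)) (by omega)).2,
    twoSlope_eq (by omega) hε h4]

theorem not_exists_isStableHeight_iff (a : ℕ) :
    (¬ ∃ b, IsStableHeight a b) ↔ a % 10 = 0 ∧ a ≠ 0 := by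
  constructor
  · intro h
    by_contra hn
    apply h
    rcases (by omega : a = 0 ∨ a = 1 ∨ 1 < a) with rfl | rfl | ha
    · exact hasConstantSpeed_zero.1
    · exact hasConstantSpeed_one.1
    · by_cases h2 : 2 ∣ a
      · exact (hasConstantSpeed_of_even ha h2 (by omega)).1
      · by_cases h5 : 5 ∣ a
        · exact (hasConstantSpeed_of_five_dvd ha (Nat.odd_iff.2 (by omega)) h5).1
        · exact (hasConstantSpeed_of_coprime ha (Nat.odd_iff.2 (by omega)) h5).1
  · rintro ⟨h, h0⟩ ⟨b, hb⟩
    exact not_isStableHeight_of_ten_dvd (by omega) (by omega) (by omega) b hb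

/-! ### The residue classes modulo `20` -/

theorem V_of_mod_twenty_eq_one {a : ℕ} (ha : 1 < a) (h : a % 20 = 1) :
    (keyDigit 0 1 a ≠ 5 → V a = v 5 ((a : ℤ) - 1)) ∧
    (keyDigit 0 1 a = 5 → V a = v 2 ((a : ℤ) - 1)) := by
  rw [← v_five_of_mod_one (by omega), ne_eq, ← keyGap_zero_one_eq_five_iff ha h]
  exact V_of_keyGap (by decide) ha h (Or.inl rfl) (by norm_num)

theorem V_of_mod_twenty_eq_eleven {a : ℕ} (ha : 1 < a) (h : a % 20 = 11) :
    (keyGap 5 1 a ≠ 5 → V a = v 5 ((a : ℤ) - 1)) ∧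
    (keyGap 5 1 a = 5 → V a = v 2 ((a : ℤ) + 1)) := by
  rw [← v_five_of_mod_one (by omega)]
  simpa only [sub_neg_eq_add] using
    V_of_keyGap (ε := -1) (by decide) ha h (Or.inr rfl) (by norm_num)

theorem V_of_mod_twenty_eq_three {a : ℕ} (ha : 1 < a) (h : a % 20 = 3) :
    (keyGap 4 3 a ≠ 5 → V a = v 5 ((a : ℤ) ^ 2 + 1)) ∧
    (keyGap 4 3 a = 5 → V a = v 2 ((a : ℤ) + 1)) := by
  rw [← v_five_of_mod_two_three (by omega)]
  simpa only [sub_neg_eq_add] using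
    V_of_keyGap (ε := -1) (by decide) ha h (Or.inr rfl) (by norm_num)

theorem V_of_mod_twenty_eq_thirteen {a : ℕ} (ha : 1 < a) (h : a % 20 = 13) :
    (keyGap 9 3 a ≠ 5 → V a = v 5 ((a : ℤ) ^ 2 + 1)) ∧
    (keyGap 9 3 a = 5 → V a = v 2 ((a : ℤ) - 1)) := by
  rw [← v_five_of_mod_two_three (by omega)]
  exact V_of_keyGap (by decide) ha h (Or.inl rfl) (by norm_num)

theorem V_of_mod_twenty_eq_seven {a : ℕ} (ha : 1 < a) (h : a % 20 = 7) :
    (keyGap 0 7 a ≠ 5 → V a = v 5 ((a : ℤ) ^ 2 + 1)) ∧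
    (keyGap 0 7 a = 5 → V a = v 2 ((a : ℤ) + 1)) := by
  rw [← v_five_of_mod_two_three (by omega)]
  simpa only [sub_neg_eq_add] using
    V_of_keyGap (ε := -1) (by decide) ha h (Or.inr rfl) (by norm_num)

theorem V_of_mod_twenty_eq_seventeen {a : ℕ} (ha : 1 < a) (h : a % 20 = 17) :
    (keyGap 5 7 a ≠ 5 → V a = v 5 ((a : ℤ) ^ 2 + 1)) ∧
    (keyGap 5 7 a = 5 → V a = v 2 ((a : ℤ) - 1)) := by
  rw [← v_five_of_mod_two_three (by omega)]
  exact V_of_keyGap (by decide) ha h (Or.inl rfl) (by norm_num)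

theorem V_of_mod_twenty_eq_nine {a : ℕ} (ha : 1 < a) (h : a % 20 = 9) :
    (keyGap 4 9 a ≠ 5 → V a = v 5 ((a : ℤ) + 1)) ∧
    (keyGap 4 9 a = 5 → V a = v 2 ((a : ℤ) - 1)) := by
  rw [← v_five_of_mod_four (by omega)]
  exact V_of_keyGap (by decide) ha h (Or.inl rfl) (by norm_num)

theorem V_of_mod_twenty_eq_nineteen {a : ℕ} (ha : 1 < a) (h : a % 20 = 19) :
    (keyDigit 9 9 a ≠ 4 → V a = v 5 ((a : ℤ) + 1)) ∧
    (keyDigit 9 9 a = 4 → V a = v 2 ((a : ℤ) + 1)) := by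
  rw [← v_five_of_mod_four (by omega), ne_eq, ← keyGap_nine_nine_eq_five_iff ha h]
  simpa only [sub_neg_eq_add] using
    V_of_keyGap (ε := -1) (by decide) ha h (Or.inr rfl) (by norm_num)

theorem mod_twenty_of_digits {a x₂ x₁ : ℕ} (h : (digit a 2, digit a 1) = (x₂, x₁)) :
    a % 20 = (10 * x₂ + x₁) % 20 := by
  obtain ⟨h2, h1⟩ := Prod.mk.inj h
  have := ten_mul_digit_two_add a
  rw [h2, h1] at this
  omega

end Tetration

open Tetration in
theorem corollary2p3 :
    -- the eight decadic integers used below are well defined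
    (∀ x₂ x₁ : ℕ, (x₂, x₁) ∈ unitEndings → ∃! y : Decadic, IsAlpha x₂ x₁ y) ∧
    -- so is the key digit relative to each of them with the same last digit
    (∀ a : ℕ, 1 < a → ∀ x₂ x₁ : ℕ, (x₂, x₁) ∈ unitEndings → digit a 1 = x₁ →
      IsKeyIndex (alpha x₂ x₁) a (keyIndex x₂ x₁ a) ∧
      (digit a 2 = x₂ → 3 ≤ keyIndex x₂ x₁ a)) ∧
    -- the bases coprime to 10
    (∀ a : ℕ, 1 < a → Nat.Coprime a 10 →
      ((digit a 2, digit a 1) = (0, 1) → keyDigit 0 1 a ≠ 5 → V a = v 5 ((a : ℤ) - 1)) ∧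
      ((digit a 2, digit a 1) = (0, 1) → keyDigit 0 1 a = 5 → V a = v 2 ((a : ℤ) - 1)) ∧
      ((digit a 2, digit a 1) = (5, 1) → keyGap 5 1 a ≠ 5 → V a = v 5 ((a : ℤ) - 1)) ∧
      ((digit a 2, digit a 1) = (5, 1) → keyGap 5 1 a = 5 → V a = v 2 ((a : ℤ) + 1)) ∧
      ((digit a 2, digit a 1) = (4, 3) → keyGap 4 3 a ≠ 5 → V a = v 5 ((a : ℤ) ^ 2 + 1)) ∧
      ((digit a 2, digit a 1) = (4, 3) → keyGap 4 3 a = 5 → V a = v 2 ((a : ℤ) + 1)) ∧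
      ((digit a 2, digit a 1) = (9, 3) → keyGap 9 3 a ≠ 5 → V a = v 5 ((a : ℤ) ^ 2 + 1)) ∧
      ((digit a 2, digit a 1) = (9, 3) → keyGap 9 3 a = 5 → V a = v 2 ((a : ℤ) - 1)) ∧
      ((digit a 2, digit a 1) = (0, 7) → keyGap 0 7 a ≠ 5 → V a = v 5 ((a : ℤ) ^ 2 + 1)) ∧
      ((digit a 2, digit a 1) = (0, 7) → keyGap 0 7 a = 5 → V a = v 2 ((a : ℤ) + 1)) ∧
      ((digit a 2, digit a 1) = (5, 7) → keyGap 5 7 a ≠ 5 → V a = v 5 ((a : ℤ) ^ 2 + 1)) ∧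
      ((digit a 2, digit a 1) = (5, 7) → keyGap 5 7 a = 5 → V a = v 2 ((a : ℤ) - 1)) ∧
      ((digit a 2, digit a 1) = (4, 9) → keyGap 4 9 a ≠ 5 → V a = v 5 ((a : ℤ) + 1)) ∧
      ((digit a 2, digit a 1) = (4, 9) → keyGap 4 9 a = 5 → V a = v 2 ((a : ℤ) - 1)) ∧
      ((digit a 2, digit a 1) = (9, 9) → keyDigit 9 9 a ≠ 4 → V a = v 5 ((a : ℤ) + 1)) ∧
      ((digit a 2, digit a 1) = (9, 9) → keyDigit 9 9 a = 4 → V a = v 2 ((a : ℤ) + 1)) ∧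
      ((digit a 2, digit a 1) ∉ unitEndings → V a = 1)) ∧
    -- all bases; in the last line, V(a) is undefined
    (∀ a : ℕ,
      (a = 0 ∨ a = 1 → V a = 0) ∧
      (a % 10 = 2 ∨ a % 10 = 8 → V a = v 5 ((a : ℤ) ^ 2 + 1)) ∧
      (a % 10 = 4 → V a = v 5 ((a : ℤ) + 1)) ∧
      (a % 10 = 6 → V a = v 5 ((a : ℤ) - 1)) ∧
      (a % 20 = 5 → V a = v 2 ((a : ℤ) - 1)) ∧
      (a % 20 = 15 → V a = v 2 ((a : ℤ) + 1)) ∧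
      (a % 20 = 1 → keyDigit 0 1 a ≠ 5 → a ≠ 1 → V a = v 5 ((a : ℤ) - 1)) ∧
      (a % 20 = 1 → keyDigit 0 1 a = 5 → V a = v 2 ((a : ℤ) - 1)) ∧
      (a % 20 = 11 → keyGap 5 1 a ≠ 5 → V a = v 5 ((a : ℤ) - 1)) ∧
      (a % 20 = 11 → keyGap 5 1 a = 5 → V a = v 2 ((a : ℤ) + 1)) ∧
      (a % 20 = 3 → keyGap 4 3 a ≠ 5 → V a = v 5 ((a : ℤ) ^ 2 + 1)) ∧
      (a % 20 = 3 → keyGap 4 3 a = 5 → V a = v 2 ((a : ℤ) + 1)) ∧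
      (a % 20 = 13 → keyGap 9 3 a ≠ 5 → V a = v 5 ((a : ℤ) ^ 2 + 1)) ∧
      (a % 20 = 13 → keyGap 9 3 a = 5 → V a = v 2 ((a : ℤ) - 1)) ∧
      (a % 20 = 7 → keyGap 0 7 a ≠ 5 → V a = v 5 ((a : ℤ) ^ 2 + 1)) ∧
      (a % 20 = 7 → keyGap 0 7 a = 5 → V a = v 2 ((a : ℤ) + 1)) ∧
      (a % 20 = 17 → keyGap 5 7 a ≠ 5 → V a = v 5 ((a : ℤ) ^ 2 + 1)) ∧
      (a % 20 = 17 → keyGap 5 7 a = 5 → V a = v 2 ((a : ℤ) - 1)) ∧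
      (a % 20 = 9 → keyGap 4 9 a ≠ 5 → V a = v 5 ((a : ℤ) + 1)) ∧
      (a % 20 = 9 → keyGap 4 9 a = 5 → V a = v 2 ((a : ℤ) - 1)) ∧
      (a % 20 = 19 → keyDigit 9 9 a ≠ 4 → V a = v 5 ((a : ℤ) + 1)) ∧
      (a % 20 = 19 → keyDigit 9 9 a = 4 → V a = v 2 ((a : ℤ) + 1)) ∧
      ((¬ ∃ b : ℕ, IsStableHeight a b) ↔ a % 10 = 0 ∧ a ≠ 0)) := by
  refine ⟨fun _ _ h => existsUnique_isAlpha h,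
    fun a ha _ _ h h1 => ⟨isKeyIndex_keyIndex h ha h1, three_le_keyIndex h ha h1⟩, ?_, ?_⟩
  · intro a ha hc
    refine ⟨fun h => (V_of_mod_twenty_eq_one ha (mod_twenty_of_digits h)).1,
      fun h => (V_of_mod_twenty_eq_one ha (mod_twenty_of_digits h)).2,
      fun h => (V_of_mod_twenty_eq_eleven ha (mod_twenty_of_digits h)).1,
      fun h => (V_of_mod_twenty_eq_eleven ha (mod_twenty_of_digits h)).2,
      fun h => (V_of_mod_twenty_eq_three ha (mod_twenty_of_digits h)).1,
      fun h => (V_of_mod_twenty_eq_three ha (mod_twenty_of_digits h)).2,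
      fun h => (V_of_mod_twenty_eq_thirteen ha (mod_twenty_of_digits h)).1,
      fun h => (V_of_mod_twenty_eq_thirteen ha (mod_twenty_of_digits h)).2,
      fun h => (V_of_mod_twenty_eq_seven ha (mod_twenty_of_digits h)).1,
      fun h => (V_of_mod_twenty_eq_seven ha (mod_twenty_of_digits h)).2,
      fun h => (V_of_mod_twenty_eq_seventeen ha (mod_twenty_of_digits h)).1,
      fun h => (V_of_mod_twenty_eq_seventeen ha (mod_twenty_of_digits h)).2,
      fun h => (V_of_mod_twenty_eq_nine ha (mod_twenty_of_digits h)).1,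
      fun h => (V_of_mod_twenty_eq_nine ha (mod_twenty_of_digits h)).2,
      fun h => (V_of_mod_twenty_eq_nineteen ha (mod_twenty_of_digits h)).1,
      fun h => (V_of_mod_twenty_eq_nineteen ha (mod_twenty_of_digits h)).2,
      V_of_not_mem_unitEndings ha hc⟩
  · intro a
    refine ⟨?_, fun h => ?_, fun h => ?_, fun h => ?_, fun h => ?_, fun h => ?_, fun h hk h1 => ?_,
      fun h hk => ?_, fun h => (V_of_mod_twenty_eq_eleven (by omega) h).1,
      fun h => (V_of_mod_twenty_eq_eleven (by omega) h).2,
      fun h => (V_of_mod_twenty_eq_three (by omega) h).1,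
      fun h => (V_of_mod_twenty_eq_three (by omega) h).2,
      fun h => (V_of_mod_twenty_eq_thirteen (by omega) h).1,
      fun h => (V_of_mod_twenty_eq_thirteen (by omega) h).2,
      fun h => (V_of_mod_twenty_eq_seven (by omega) h).1,
      fun h => (V_of_mod_twenty_eq_seven (by omega) h).2,
      fun h => (V_of_mod_twenty_eq_seventeen (by omega) h).1,
      fun h => (V_of_mod_twenty_eq_seventeen (by omega) h).2,
      fun h => (V_of_mod_twenty_eq_nine (by omega) h).1,
      fun h => (V_of_mod_twenty_eq_nine (by omega) h).2,
      fun h => (V_of_mod_twenty_eq_nineteen (by omega) h).1,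
      fun h => (V_of_mod_twenty_eq_nineteen (by omega) h).2,
      not_exists_isStableHeight_iff a⟩
    · rintro (rfl | rfl)
      · exact hasConstantSpeed_zero.2
      · exact hasConstantSpeed_one.2
    · rw [V_of_even (by omega) (by omega), v_five_of_mod_two_three (by omega)]
    · rw [V_of_even (by omega) (by omega), v_five_of_mod_four (by omega)]
    · rw [V_of_even (by omega) (by omega), v_five_of_mod_one (by omega)]
    · exact V_of_five_dvd (by omega) (Or.inl rfl) (by omega)
    · simpa only [sub_neg_eq_add] using
        V_of_five_dvd (a := a) (ε := -1) (by omega) (Or.inr rfl) (by omega)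
    · exact (V_of_mod_twenty_eq_one (by omega) h).1 hk
    · have ha : a ≠ 1 := by
        rintro rfl
        rw [keyDigit_zero_one_one] at hk
        omega
      exact (V_of_mod_twenty_eq_one (by omega) h).2 hk
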